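/- **Theorem.** The octahedron graph, i.e. the simple graph $K_{2,2,2}$ on six vertices forming three antipodal pairs, in which two distinct vertices are adjacent if and only if they are not antipodal, is planar, triconnected and of maximum degree $4$, and it is not outer-RAC. In particular, there is a planar triconnected graph of maximum degree $4$ that is not outer-RAC. Here a graph is *planar* if it admits a drawing in the Euclidean plane (vertices are distinct points, edges are simple arcs joining their endpoints and passing through no other vertex) in which no two edges intersect except at a common endpoint. It is *triconnected* if it has more than $3$ vertices and remains connected after the deletion of any set of fewer than $3$ vertices. A *straight-line drawing* of a graph places the vertices at distinct points of the Euclidean plane and represents each edge by the line segment between its endpoints, such that no edge contains a vertex other than its endpoints. The *cells* of the drawing are the connected components of the complement of the drawing in the plane, and the *outer cell* is the unbounded one. A straight-line drawing is *outer-RAC* if any two edges that cross (i.e. share a point that is interior to both) are perpendicular and every vertex lies on the boundary of the outer cell. A graph is *outer-RAC* if it admits an outer-RAC drawing. -/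

import Mathlib

/-- The Euclidean plane. -/
abbrev Plane : Type := EuclideanSpace ℝ (Fin 2)

namespace SimpleGraph

/-- A graph is planar if it admits a planar drawing: vertices are distinct points, every edge is
a simple arc joining its endpoints, no arc passes through a vertex that is not one of its
endpoints, and two distinct arcs meet only in the points of common endpoints. -/
def IsPlanar {V : Type*} (G : SimpleGraph V) : Prop :=
  ∃ (pos : V → Plane) (arc : Sym2 V → Set Plane),
    Function.Injective pos ∧
    (∀ u v, G.Adj u v →
      ∃ γ : _root_.Path (pos u) (pos v), Function.Injective γ ∧ Set.range γ = arc s(u, v)) ∧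
    (∀ e ∈ G.edgeSet, ∀ w, pos w ∈ arc e → w ∈ e) ∧
    (∀ e ∈ G.edgeSet, ∀ f ∈ G.edgeSet, e ≠ f →
      arc e ∩ arc f ⊆ pos '' {w | w ∈ e ∧ w ∈ f})

/-- `G` is `k`-connected: it has more than `k` vertices, and deleting fewer than `k` vertices
always leaves a connected graph. -/
def IsVertexKConnected {V : Type*} (G : SimpleGraph V) (k : ℕ) : Prop :=
  (k : ℕ∞) < ENat.card V ∧
    ∀ X : Finset V, X.card < k → (G.induce {v : V | v ∉ X}).Connected

/-- Triconnected graphs are the 3-connected graphs. -/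
def IsTriconnected {V : Type*} (G : SimpleGraph V) : Prop :=
  G.IsVertexKConnected 3

/-- A placement of the vertices defines a straight-line drawing, each edge `uv` being the segment
between the points of `u` and `v`: vertices are distinct points, and no edge passes through a
vertex that is not one of its endpoints. -/
def IsStraightLineDrawing {V : Type*} (G : SimpleGraph V) (pos : V → Plane) : Prop :=
  Function.Injective pos ∧
    ∀ u v w, G.Adj u v → pos w ∈ segment ℝ (pos u) (pos v) → w = u ∨ w = v

/-- The set of points of the plane covered by a straight-line drawing. -/
def drawingSupport {V : Type*} (G : SimpleGraph V) (pos : V → Plane) : Set Plane :=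
  Set.range pos ∪ {p | ∃ u v, G.Adj u v ∧ p ∈ segment ℝ (pos u) (pos v)}

/-- The outer cell of a straight-line drawing: the points off the drawing whose connected
component (cell) in the complement of the drawing is unbounded. -/
def outerCell {V : Type*} (G : SimpleGraph V) (pos : V → Plane) : Set Plane :=
  {p | p ∈ (G.drawingSupport pos)ᶜ ∧
    ¬ Bornology.IsBounded (connectedComponentIn (G.drawingSupport pos)ᶜ p)}

/-- An outer-RAC drawing: a straight-line drawing in which any two distinct edges that cross
(have a common point interior to both) are perpendicular, and every vertex is incident to the
outer cell. -/
def IsOuterRACDrawing {V : Type*} (G : SimpleGraph V) (pos : V → Plane) : Prop :=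
  G.IsStraightLineDrawing pos ∧
  (∀ a b c d, G.Adj a b → G.Adj c d → s(a, b) ≠ s(c, d) →
    (openSegment ℝ (pos a) (pos b) ∩ openSegment ℝ (pos c) (pos d)).Nonempty →
    inner ℝ (pos b - pos a) (pos d - pos c) = 0) ∧
  (∀ v, pos v ∈ closure (G.outerCell pos))

/-- A graph is outer-RAC if it admits an outer-RAC drawing. -/
def IsOuterRAC {V : Type*} (G : SimpleGraph V) : Prop :=
  ∃ pos : V → Plane, G.IsOuterRACDrawing pos

/-- The graph of the octahedron: three antipodal pairs of vertices `(i, 0)`, `(i, 1)`, two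
vertices being adjacent unless they are equal or antipodal. -/
abbrev octahedron : SimpleGraph (Fin 3 × Fin 2) :=
  completeEquipartiteGraph 3 2

end SimpleGraph

/-! Two local obstructions drive the non-existence proof. A triangle of the graph contains no fourth
vertex, since its interior is cut off from the outer cell (`triangle_empty`). No edge is crossed by
two edges with a common end: both would be perpendicular to it, hence overlap, and one would pass
through a vertex (`no_fan`).

Every neighbourhood in the octahedron is a 4-cycle, so each vertex is the hub of a wheel. A sign
analysis with the two obstructions shows that the two rim neighbours of a rim vertex `b` are
separated by the line through `b` and the hub (`wheel`). So replacing a corner of a face by its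
antipode reverses the orientation of the face, and the sign of a face depends only on the parity of
its antipodal choices. The faces of a closed surface, coherently oriented, have total signed area
zero, yet here all eight terms have the same strict sign.

Planarity is certified by explicit coordinates; connectivity and degree are finite checks. -/

namespace SimpleGraph

/-! ### Signed areas and barycentric coordinates -/

/-- Twice the signed area of the triangle `pqr`. -/
noncomputable def orient (p q r : Plane) : ℝ :=
  (q 0 - p 0) * (r 1 - p 1) - (q 1 - p 1) * (r 0 - p 0)

theorem orient_rotate (p q r : Plane) : orient q r p = orient p q r := by
  simp only [orient]; ring

theorem orient_swap (p q r : Plane) : orient q p r = -orient p q r := by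
  simp only [orient]; ring

theorem continuous_orient (p q : Plane) : Continuous (orient p q) := by
  unfold orient; fun_prop

/-- Barycentric coordinates with respect to the triangle `pqr`. -/
theorem orient_smul_add (p q r x : Plane) :
    orient q r x • p + orient r p x • q + orient p q x • r = orient p q r • x := by
  ext i
  fin_cases i <;> simp [orient] <;> ring

theorem orient_add (p q r x : Plane) :
    orient q r x + orient r p x + orient p q x = orient p q r := by
  simp only [orient]; ring

theorem mem_convexHull_triangle {p q r x : Plane} (h : 0 < orient p q r)
    (h₁ : 0 ≤ orient p q x) (h₂ : 0 ≤ orient q r x) (h₃ : 0 ≤ orient r p x) :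
    x ∈ convexHull ℝ {p, q, r} := by
  have key := (convex_convexHull ℝ ({p, q, r} : Set Plane)).sum_mem
    (t := (Finset.univ : Finset (Fin 3)))
    (w := ![orient q r x / orient p q r, orient r p x / orient p q r, orient p q x / orient p q r])
    (z := ![p, q, r])
    (by
      intro i _
      fin_cases i
      · exact div_nonneg h₂ h.le
      · exact div_nonneg h₃ h.le
      · exact div_nonneg h₁ h.le)
    (by
      have := orient_add p q r x
      simp only [Fin.sum_univ_three, Matrix.cons_val]
      field_simp
      linarith)
    (by
      intro i _
      apply subset_convexHull
      fin_cases i <;> simp)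
  convert key
  apply smul_right_injective _ h.ne'
  simp only [Fin.sum_univ_three, Matrix.cons_val, smul_add, smul_smul, mul_div_cancel₀ _ h.ne']
  exact (orient_smul_add p q r x).symm

theorem mem_segment_of_orient_eq_zero {p q r x : Plane} (h : 0 < orient p q r)
    (h₁ : orient p q x = 0) (h₂ : 0 ≤ orient q r x) (h₃ : 0 ≤ orient r p x) :
    x ∈ segment ℝ p q := by
  have hs := orient_add p q r x
  refine ⟨orient q r x / orient p q r, orient r p x / orient p q r, div_nonneg h₂ h.le,
    div_nonneg h₃ h.le, ?_, ?_⟩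
  · field_simp
    linarith
  · apply smul_right_injective _ h.ne'
    have := orient_smul_add p q r x
    rw [h₁, zero_smul, add_zero] at this
    simp only [smul_add, smul_smul, mul_div_cancel₀ _ h.ne']
    exact this

theorem wbtw_of_orient_eq_zero {p q r : Plane} (h : orient p q r = 0) :
    Wbtw ℝ p q r ∨ Wbtw ℝ q r p ∨ Wbtw ℝ r p q := by
  rcases eq_or_ne p q with rfl | hne
  · exact Or.inl (wbtw_self_left ℝ _ _)
  apply Collinear.wbtw_or_wbtw_or_wbtw
  rw [collinear_iff_of_mem (p₀ := p) (by simp)]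
  refine ⟨q - p, ?_⟩
  simp only [Set.mem_insert_iff, Set.mem_singleton_iff, forall_eq_or_imp, forall_eq]
  refine ⟨⟨0, by simp⟩, ⟨1, by simp⟩, ?_⟩
  unfold orient at h
  by_cases h0 : q 0 - p 0 = 0
  · have h1 : q 1 - p 1 ≠ 0 := by
      intro h1
      apply hne
      ext i
      fin_cases i
      · simp; linarith
      · simp; linarith
    have h2 : r 0 - p 0 = 0 := by
      rw [h0, zero_mul, zero_sub, neg_eq_zero] at h
      exact (mul_eq_zero.1 h).resolve_left h1
    refine ⟨(r 1 - p 1) / (q 1 - p 1), ?_⟩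
    ext i
    fin_cases i
    · simp [h0]; linarith
    · simp [div_mul_cancel₀ _ h1]
  · refine ⟨(r 0 - p 0) / (q 0 - p 0), ?_⟩
    ext i
    fin_cases i
    · simp [div_mul_cancel₀ _ h0]
    · simp
      field_simp
      linarith

/-! ### Crossing segments -/

/-- The segments `pq` and `rs` cross transversally in a point interior to both. -/
def Crosses (p q r s : Plane) : Prop :=
  orient p q r * orient p q s < 0 ∧ orient r s p * orient r s q < 0

/-- An affine function with values `a`, `b` of opposite sign at the ends of a segment vanishes at
the point with weights `-b / (a - b)` and `a / (a - b)`. -/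
theorem div_sub_pos_of_mul_neg {a b : ℝ} (h : a * b < 0) : 0 < a / (a - b) ∧ 0 < -b / (a - b) := by
  rcases mul_neg_iff.1 h with ⟨ha, hb⟩ | ⟨ha, hb⟩
  · exact ⟨div_pos ha (by linarith), div_pos (by linarith) (by linarith)⟩
  · exact ⟨div_pos_of_neg_of_neg ha (by linarith),
      div_pos_of_neg_of_neg (by linarith) (by linarith)⟩

theorem Crosses.nonempty_inter {p q r s : Plane} (h : Crosses p q r s) :
    (openSegment ℝ p q ∩ openSegment ℝ r s).Nonempty := by
  obtain ⟨h₁, h₂⟩ := h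
  obtain ⟨hr, hs⟩ := div_sub_pos_of_mul_neg h₁
  obtain ⟨hp, hq⟩ := div_sub_pos_of_mul_neg h₂
  -- Up to sign, the weights along both segments have the same denominator, so the two expressions
  -- for the crossing point can be compared.
  have e : orient p q r - orient p q s = -(orient r s p - orient r s q) := by
    simp only [orient]; ring
  have n : orient r s p - orient r s q ≠ 0 := by
    intro h0
    rw [h0] at hp
    simp at hp
  have n' : orient p q r - orient p q s ≠ 0 := by rw [e]; exact neg_ne_zero.2 n
  refine ⟨(-orient r s q / (orient r s p - orient r s q)) • p +
    (orient r s p / (orient r s p - orient r s q)) • q, ⟨_, _, hq, hp, ?_, rfl⟩,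
    ⟨_, _, hs, hr, ?_, ?_⟩⟩
  · field_simp; ring
  · field_simp; ring
  · rw [e]
    simp only [div_neg, neg_div, neg_neg, neg_smul]
    apply smul_right_injective _ n
    simp only [smul_add, smul_neg, smul_smul, mul_div_cancel₀ _ n]
    ext i
    fin_cases i <;> simp [orient] <;> ring

theorem mem_segment_of_smul_eq {r s t : Plane} {a b : ℝ} (hab : 0 < a * b) (hle : a ^ 2 ≤ b ^ 2)
    (h : b • (s - r) = a • (t - r)) : s ∈ segment ℝ r t := by
  have hb : b ≠ 0 := right_ne_zero_of_mul hab.ne'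
  rw [segment_eq_image']
  refine ⟨a / b, ⟨?_, ?_⟩, ?_⟩
  · rw [← mul_div_mul_right a b hb]
    exact (div_pos hab (mul_self_pos.2 hb)).le
  · rw [← mul_div_mul_right a b hb, div_le_one (mul_self_pos.2 hb)]
    nlinarith [sq_nonneg (a - b)]
  · apply smul_right_injective _ hb
    simp only [smul_add, smul_smul, mul_div_cancel₀ _ hb]
    rw [← h, ← smul_add, add_sub_cancel]

/-! ### Forbidden configurations in outer-RAC drawings -/

variable {V : Type*} {G : SimpleGraph V} {pos : V → Plane}

/-- A cell that meets `U` cannot leave it without hitting the frontier, which belongs to the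
drawing. So every cell meeting `U` is bounded. -/
theorem notMem_closure_outerCell {U : Set Plane} (hU : IsOpen U) (hb : Bornology.IsBounded U)
    (hf : frontier U ⊆ G.drawingSupport pos) {p : Plane} (hp : p ∈ U) :
    p ∉ closure (G.outerCell pos) := by
  intro hcl
  obtain ⟨q, hqU, hqD, hq⟩ := mem_closure_iff.1 hcl U hU hp
  refine hq (hb.subset ?_)
  refine isPreconnected_connectedComponentIn.subset_left_of_subset_union hU
    isClosed_closure.isOpen_compl (disjoint_compl_right.mono_left subset_closure) ?_
    ⟨q, mem_connectedComponentIn hqD, hqU⟩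
  intro x hx
  by_cases hxc : x ∈ closure U
  · left
    by_contra hxU
    exact connectedComponentIn_subset _ _ hx (hf (hU.frontier_eq ▸ ⟨hxc, hxU⟩))
  · exact Or.inr hxc

/-- A triangle `uvw` of the graph contains no vertex `z` other than its corners. -/
theorem IsOuterRACDrawing.triangle_empty (h : G.IsOuterRACDrawing pos) {u v w z : V}
    (huv : G.Adj u v) (hvw : G.Adj v w) (hwu : G.Adj w u) (hu : z ≠ u) (hv : z ≠ v) (hw : z ≠ w)
    (h0 : 0 < orient (pos u) (pos v) (pos w)) (h₁ : 0 ≤ orient (pos u) (pos v) (pos z))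
    (h₂ : 0 ≤ orient (pos v) (pos w) (pos z)) (h₃ : 0 ≤ orient (pos w) (pos u) (pos z)) :
    False := by
  have side {u v w : V} {x : Plane} (h0 : 0 < orient (pos u) (pos v) (pos w))
      (h₁ : 0 ≤ orient (pos u) (pos v) x) (h₂ : 0 ≤ orient (pos v) (pos w) x)
      (h₃ : 0 ≤ orient (pos w) (pos u) x) (hx : ¬ 0 < orient (pos u) (pos v) x) :
      x ∈ segment ℝ (pos u) (pos v) :=
    mem_segment_of_orient_eq_zero h0 (le_antisymm (not_lt.1 hx) h₁) h₂ h₃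
  have h0' : 0 < orient (pos v) (pos w) (pos u) := by rwa [orient_rotate]
  have h0'' : 0 < orient (pos w) (pos u) (pos v) := by rwa [orient_rotate]
  have p₁ : 0 < orient (pos u) (pos v) (pos z) := by
    by_contra hx
    rcases h.1.2 _ _ _ huv (side h0 h₁ h₂ h₃ hx) with e | e
    exacts [hu e, hv e]
  have p₂ : 0 < orient (pos v) (pos w) (pos z) := by
    by_contra hx
    rcases h.1.2 _ _ _ hvw (side h0' h₂ h₃ h₁ hx) with e | e
    exacts [hv e, hw e]
  have p₃ : 0 < orient (pos w) (pos u) (pos z) := by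
    by_contra hx
    rcases h.1.2 _ _ _ hwu (side h0'' h₃ h₁ h₂ hx) with e | e
    exacts [hw e, hu e]
  have hopen (p q : Plane) : IsOpen {x | 0 < orient p q x} :=
    isOpen_lt continuous_const (continuous_orient p q)
  have hclosed (p q : Plane) : IsClosed {x | 0 ≤ orient p q x} :=
    isClosed_le continuous_const (continuous_orient p q)
  have hU := ((hopen (pos u) (pos v)).inter (hopen (pos v) (pos w))).inter (hopen (pos w) (pos u))
  refine notMem_closure_outerCell (G := G) (pos := pos) hU ?_ ?_ ⟨⟨p₁, p₂⟩, p₃⟩ (h.2.2 z)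
  · have hfin : ({pos u, pos v, pos w} : Set Plane).Finite := by simp
    refine (isBounded_convexHull.2 hfin.isBounded).subset ?_
    rintro x ⟨⟨q₁, q₂⟩, q₃⟩
    exact mem_convexHull_triangle h0 (le_of_lt q₁) (le_of_lt q₂) (le_of_lt q₃)
  · rw [hU.frontier_eq]
    rintro x ⟨hx, hxU⟩
    have hc : x ∈ ({x | 0 ≤ orient (pos u) (pos v) x} ∩ {x | 0 ≤ orient (pos v) (pos w) x}) ∩
        {x | 0 ≤ orient (pos w) (pos u) x} := by
      have hle (p q : Plane) : {x | 0 < orient p q x} ⊆ {x | 0 ≤ orient p q x} :=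
        Set.ofPred_subset_ofPred.2 fun _ => le_of_lt
      exact closure_minimal
        (Set.inter_subset_inter (Set.inter_subset_inter (hle _ _) (hle _ _)) (hle _ _))
        (((hclosed _ _).inter (hclosed _ _)).inter (hclosed _ _)) hx
    obtain ⟨⟨q₁, q₂⟩, q₃⟩ := hc
    right
    by_cases c₁ : 0 < orient (pos u) (pos v) x
    · by_cases c₂ : 0 < orient (pos v) (pos w) x
      · by_cases c₃ : 0 < orient (pos w) (pos u) x
        · exact absurd ⟨⟨c₁, c₂⟩, c₃⟩ hxU
        · exact ⟨_, _, hwu, side h0'' q₃ q₁ q₂ c₃⟩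
      · exact ⟨_, _, hvw, side h0' q₂ q₃ q₁ c₂⟩
    · exact ⟨_, _, huv, side h0 q₁ q₂ q₃ c₁⟩

/-- Of three collinear points one lies between the other two, so a flat triangle would have a vertex
on its opposite edge. -/
theorem IsStraightLineDrawing.orient_ne_zero (h : G.IsStraightLineDrawing pos) {u v w : V}
    (huv : G.Adj u v) (hvw : G.Adj v w) (hwu : G.Adj w u) :
    orient (pos u) (pos v) (pos w) ≠ 0 := by
  intro h0
  rcases wbtw_of_orient_eq_zero h0 with hb | hb | hb
  · rcases h.2 _ _ _ hwu.symm (mem_segment_iff_wbtw.2 hb) with e | e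
    exacts [huv.ne e.symm, hvw.ne e]
  · rcases h.2 _ _ _ huv.symm (mem_segment_iff_wbtw.2 hb) with e | e
    exacts [hvw.ne e.symm, hwu.ne e]
  · rcases h.2 _ _ _ hvw.symm (mem_segment_iff_wbtw.2 hb) with e | e
    exacts [hwu.ne e.symm, huv.ne e]

theorem IsOuterRACDrawing.inner_eq_zero_of_crosses (h : G.IsOuterRACDrawing pos) {x y r s : V}
    (hxy : G.Adj x y) (hrs : G.Adj r s) (hc : Crosses (pos x) (pos y) (pos r) (pos s)) :
    inner ℝ (pos y - pos x) (pos s - pos r) = 0 := by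
  refine h.2.1 _ _ _ _ hxy hrs ?_ hc.nonempty_inter
  intro e
  have h1 := hc.1
  rcases Sym2.eq_iff.1 e with ⟨rfl, rfl⟩ | ⟨rfl, rfl⟩ <;> simp [orient] at h1

/-- No edge is crossed by two edges with a common endpoint. -/
theorem IsOuterRACDrawing.no_fan (h : G.IsOuterRACDrawing pos) {x y r s t : V}
    (hxy : G.Adj x y) (hrs : G.Adj r s) (hrt : G.Adj r t) (hst : s ≠ t)
    (hs : Crosses (pos x) (pos y) (pos r) (pos s))
    (ht : Crosses (pos x) (pos y) (pos r) (pos t)) : False := by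
  have i₁ := h.inner_eq_zero_of_crosses hxy hrs hs
  have i₂ := h.inner_eq_zero_of_crosses hxy hrt ht
  simp only [PiLp.inner_apply, Fin.sum_univ_two, PiLp.sub_apply, RCLike.inner_apply,
    conj_trivial] at i₁ i₂
  -- `a` and `b` are proportional to the signed lengths of `rs` and `rt` along the normal of `xy`.
  -- They have the same sign because `s` and `t` both lie across `xy` from `r`.
  set a := orient (pos x) (pos y) (pos s) - orient (pos x) (pos y) (pos r) with ha
  set b := orient (pos x) (pos y) (pos t) - orient (pos x) (pos y) (pos r) with hb
  have hab : 0 < a * b := by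
    have h1 := hs.1
    have h2 := ht.1
    rcases mul_neg_iff.1 h1 with ⟨k₁, k₂⟩ | ⟨k₁, k₂⟩
    · exact mul_pos_of_neg_of_neg (by linarith) (by nlinarith)
    · exact mul_pos (by linarith) (by nlinarith)
  have e : b • (pos s - pos r) = a • (pos t - pos r) := by
    ext i
    fin_cases i
    · simp [ha, hb, orient]
      linear_combination (pos t 1 - pos r 1) * i₁ - (pos s 1 - pos r 1) * i₂
    · simp [ha, hb, orient]
      linear_combination (pos s 0 - pos r 0) * i₂ - (pos t 0 - pos r 0) * i₁
  -- The shorter of the overlapping edges `rs`, `rt` ends on the longer one.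
  rcases le_total (a ^ 2) (b ^ 2) with hle | hle
  · rcases h.1.2 _ _ _ hrt (mem_segment_of_smul_eq hab hle e) with e | e
    exacts [hrs.ne e.symm, hst e]
  · rcases h.1.2 _ _ _ hrs (mem_segment_of_smul_eq (by rwa [mul_comm]) hle e.symm) with e | e
    exacts [hrt.ne e.symm, hst e.symm]

/-- If two triangles over an edge `xy` lie on the same side of it, then neither contains the
apex of the other, so that two of their sides cross. -/
theorem IsOuterRACDrawing.same_side (h : G.IsOuterRACDrawing pos) {x y u v : V}
    (hxy : G.Adj x y) (hxu : G.Adj x u) (hyu : G.Adj y u) (hxv : G.Adj x v) (hyv : G.Adj y v)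
    (huv : u ≠ v) (hu : 0 < orient (pos x) (pos y) (pos u))
    (hv : 0 < orient (pos x) (pos y) (pos v)) :
    (0 < orient (pos y) (pos u) (pos v) ∧ orient (pos u) (pos x) (pos v) < 0) ∨
      (orient (pos y) (pos u) (pos v) < 0 ∧ 0 < orient (pos u) (pos x) (pos v)) := by
  have e₁ : orient (pos y) (pos v) (pos u) = -orient (pos y) (pos u) (pos v) := by
    unfold orient; ring
  have e₂ : orient (pos v) (pos x) (pos u) = -orient (pos u) (pos x) (pos v) := by
    unfold orient; ring
  have k₁ : ¬ (0 ≤ orient (pos y) (pos u) (pos v) ∧ 0 ≤ orient (pos u) (pos x) (pos v)) :=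
    fun k => h.triangle_empty hxy hyu hxu.symm hxv.ne' hyv.ne' huv.symm hu hv.le k.1 k.2
  have k₂ : ¬ (orient (pos y) (pos u) (pos v) ≤ 0 ∧ orient (pos u) (pos x) (pos v) ≤ 0) :=
    fun k => h.triangle_empty hxy hyv hxv.symm hxu.ne' hyu.ne' huv hv hu.le
      (by linarith [k.1]) (by linarith [k.2])
  grind

/-- In a wheel with hub `c` whose rim passes through `a`, `b`, `a'`, `b'`, the rim neighbours
`a`, `a'` of `b` are not both to the left of the line from `b` to `c` such that the edges `ab`
and `a'c` cross. -/
theorem IsOuterRACDrawing.wheel_aux (h : G.IsOuterRACDrawing pos) {a b a' b' c : V}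
    (hca : G.Adj c a) (hcb : G.Adj c b) (hca' : G.Adj c a') (hcb' : G.Adj c b')
    (hab : G.Adj a b) (hba' : G.Adj b a') (ha'b' : G.Adj a' b') (hb'a : G.Adj b' a)
    (hne : a ≠ a') (hb : b ≠ b')
    (h₁ : 0 < orient (pos b) (pos c) (pos a)) (h₂ : 0 < orient (pos b) (pos c) (pos a'))
    (hP : 0 < orient (pos c) (pos a) (pos a')) (hQ : orient (pos a) (pos b) (pos a') < 0) :
    False := by
  -- Three-term Grassmann–Plücker relations, based at `a'`, `a` and `c`.
  have g₁ : orient (pos a') (pos b') (pos a) * orient (pos b) (pos c) (pos a') +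
      orient (pos a') (pos b') (pos b) * orient (pos c) (pos a) (pos a') +
      orient (pos c) (pos a') (pos b') * orient (pos a) (pos b) (pos a') = 0 := by
    unfold orient; ring
  have g₂ : orient (pos a') (pos b') (pos a) * orient (pos b) (pos c) (pos a) +
      orient (pos a) (pos b) (pos a') * orient (pos c) (pos a) (pos b') -
      orient (pos c) (pos a) (pos a') * orient (pos a) (pos b) (pos b') = 0 := by
    unfold orient; ring
  have g₃ : orient (pos c) (pos a) (pos a') * orient (pos b) (pos c) (pos b') +
      orient (pos b) (pos c) (pos a) * orient (pos c) (pos a') (pos b') -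
      orient (pos c) (pos a) (pos b') * orient (pos b) (pos c) (pos a') = 0 := by
    unfold orient; ring
  -- If `b'` were on the same side of `ca` as `b`, then either `a'c` would be crossed by `ab` and
  -- `ab'`, or `ab` by `ca'` and `cb'`.
  have hR : orient (pos c) (pos a) (pos b') < 0 := by
    by_contra hR
    have hR : 0 < orient (pos c) (pos a) (pos b') :=
      lt_of_le_of_ne (not_lt.1 hR) (h.1.orient_ne_zero hca hb'a.symm hcb'.symm).symm
    have h₁' : 0 < orient (pos c) (pos a) (pos b) := by rwa [orient_rotate]
    rcases h.same_side hca hcb hab hcb' hb'a.symm hb h₁' hR with ⟨hZ, hY⟩ | ⟨hZ, hY⟩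
    · have hT : 0 < orient (pos a') (pos b') (pos a) := by
        have := mul_pos hP hZ
        have := mul_neg_of_neg_of_pos hQ hR
        exact pos_of_mul_pos_left (by linarith) h₁.le
      have hS : 0 < orient (pos c) (pos a') (pos b') := by
        have := mul_neg_of_pos_of_neg hP hY
        have := mul_pos hR h₂
        exact pos_of_mul_pos_right (by linarith) h₁.le
      have k₁ : Crosses (pos a') (pos c) (pos a) (pos b) := by
        unfold Crosses
        rw [show orient (pos a') (pos c) (pos a) = orient (pos c) (pos a) (pos a') by
            unfold orient; ring,
          show orient (pos a') (pos c) (pos b) = -orient (pos b) (pos c) (pos a') by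
            unfold orient; ring,
          show orient (pos a) (pos b) (pos c) = orient (pos b) (pos c) (pos a) by
            unfold orient; ring]
        constructor <;> nlinarith
      have k₂ : Crosses (pos a') (pos c) (pos a) (pos b') := by
        unfold Crosses
        rw [show orient (pos a') (pos c) (pos a) = orient (pos c) (pos a) (pos a') by
            unfold orient; ring,
          show orient (pos a') (pos c) (pos b') = -orient (pos c) (pos a') (pos b') by
            unfold orient; ring,
          show orient (pos a) (pos b') (pos a') = -orient (pos a') (pos b') (pos a) by
            unfold orient; ring,
          show orient (pos a) (pos b') (pos c) = orient (pos c) (pos a) (pos b') by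
            unfold orient; ring]
        constructor <;> nlinarith
      exact h.no_fan hca'.symm hab hb'a.symm hb k₁ k₂
    · have k₁ : Crosses (pos a) (pos b) (pos c) (pos a') := by
        unfold Crosses
        rw [show orient (pos a) (pos b) (pos c) = orient (pos b) (pos c) (pos a) by
            unfold orient; ring,
          show orient (pos c) (pos a') (pos a) = -orient (pos c) (pos a) (pos a') by
            unfold orient; ring,
          show orient (pos c) (pos a') (pos b) = orient (pos b) (pos c) (pos a') by
            unfold orient; ring]
        constructor <;> nlinarith
      have k₂ : Crosses (pos a) (pos b) (pos c) (pos b') := by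
        unfold Crosses
        rw [show orient (pos a) (pos b) (pos c) = orient (pos b) (pos c) (pos a) by
            unfold orient; ring,
          show orient (pos c) (pos b') (pos a) = -orient (pos c) (pos a) (pos b') by
            unfold orient; ring,
          show orient (pos c) (pos b') (pos b) = orient (pos b) (pos c) (pos b') by
            unfold orient; ring]
        constructor <;> nlinarith
      exact h.no_fan hab hca' hcb' ha'b'.ne k₁ k₂
  -- If `a'b'` separates `a` from `b` in this way, then `ab` is crossed by both `a'c` and `a'b'`.
  have fan (hT : 0 < orient (pos a') (pos b') (pos a))
      (hW : orient (pos a') (pos b') (pos b) < 0) : False := by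
    have hZ : 0 < orient (pos a) (pos b) (pos b') := by
      have := mul_pos hT h₁
      have := mul_pos_of_neg_of_neg hQ hR
      exact pos_of_mul_pos_right (by linarith) hP.le
    have k₁ : Crosses (pos a) (pos b) (pos a') (pos c) := by
      unfold Crosses
      rw [show orient (pos a) (pos b) (pos c) = orient (pos b) (pos c) (pos a) by
          unfold orient; ring,
        show orient (pos a') (pos c) (pos a) = orient (pos c) (pos a) (pos a') by
          unfold orient; ring,
        show orient (pos a') (pos c) (pos b) = -orient (pos b) (pos c) (pos a') by
          unfold orient; ring]
      constructor <;> nlinarith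
    have k₂ : Crosses (pos a) (pos b) (pos a') (pos b') := by
      unfold Crosses
      constructor <;> nlinarith
    exact h.no_fan hab hca'.symm ha'b' hcb'.ne k₁ k₂
  -- For either orientation of `c a' b'`, an empty triangle gives one hypothesis of `fan` (otherwise
  -- it would contain `a`, respectively `b`), and `g₁` gives the other.
  rcases lt_or_gt_of_ne (h.1.orient_ne_zero hca' ha'b' hcb'.symm) with hS | hS
  · have hT : 0 < orient (pos a') (pos b') (pos a) := by
      by_contra hT
      refine h.triangle_empty hcb' ha'b'.symm hca'.symm hca.ne' hb'a.ne' hne ?_ ?_ ?_ ?_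
      · rw [show orient (pos c) (pos b') (pos a') = -orient (pos c) (pos a') (pos b') by
          unfold orient; ring]
        linarith
      · rw [show orient (pos c) (pos b') (pos a) = -orient (pos c) (pos a) (pos b') by
          unfold orient; ring]
        linarith
      · rw [show orient (pos b') (pos a') (pos a) = -orient (pos a') (pos b') (pos a) by
          unfold orient; ring]
        linarith
      · rw [show orient (pos a') (pos c) (pos a) = orient (pos c) (pos a) (pos a') by
          unfold orient; ring]
        linarith
    refine fan hT ?_
    have := mul_pos hT h₂
    have := mul_pos_of_neg_of_neg hS hQ
    exact neg_of_mul_neg_left (by linarith) hP.le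
  · have hY : orient (pos b) (pos c) (pos b') < 0 := by
      have := mul_pos h₁ hS
      have := mul_neg_of_neg_of_pos hR h₂
      exact neg_of_mul_neg_right (by linarith) hP.le
    have hW : orient (pos a') (pos b') (pos b) < 0 := by
      by_contra hW
      refine h.triangle_empty hca' ha'b' hcb'.symm hcb.ne' hba'.ne hb hS ?_ ?_ ?_
      · rw [show orient (pos c) (pos a') (pos b) = orient (pos b) (pos c) (pos a') by
          unfold orient; ring]
        linarith
      · linarith
      · rw [show orient (pos b') (pos c) (pos b) = -orient (pos b) (pos c) (pos b') by
          unfold orient; ring]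
        linarith
    refine fan ?_ hW
    have := mul_neg_of_neg_of_pos hW hP
    have := mul_neg_of_pos_of_neg hS hQ
    exact pos_of_mul_pos_left (by linarith) h₂.le

/-- In a wheel with hub `c` whose rim passes through `a`, `b`, `a'`, `b'`, the rim neighbours
`a`, `a'` of `b` are not both to the left of the line from `b` to `c`. -/
theorem IsOuterRACDrawing.wheel (h : G.IsOuterRACDrawing pos) {a b a' b' c : V}
    (hca : G.Adj c a) (hcb : G.Adj c b) (hca' : G.Adj c a') (hcb' : G.Adj c b')
    (hab : G.Adj a b) (hba' : G.Adj b a') (ha'b' : G.Adj a' b') (hb'a : G.Adj b' a)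
    (hne : a ≠ a') (hb : b ≠ b')
    (h₁ : 0 < orient (pos b) (pos c) (pos a)) (h₂ : 0 < orient (pos b) (pos c) (pos a')) :
    False := by
  rcases h.same_side hcb.symm hab.symm hca hba' hca' hne h₁ h₂ with ⟨hP, hQ⟩ | ⟨hP, hQ⟩
  · exact h.wheel_aux hca hcb hca' hcb' hab hba' ha'b' hb'a hne hb h₁ h₂ hP hQ
  · refine h.wheel_aux hca' hcb hca hcb' hba'.symm hab.symm hb'a.symm ha'b'.symm hne.symm hb
      h₂ h₁ ?_ ?_
    · rw [show orient (pos c) (pos a') (pos a) = -orient (pos c) (pos a) (pos a') by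
        unfold orient; ring]
      linarith
    · rw [show orient (pos a') (pos b) (pos a) = -orient (pos a) (pos b) (pos a') by
        unfold orient; ring]
      linarith

/-! ### Alternating signs of the faces of the octahedron -/

theorem IsOuterRACDrawing.octahedron_wheel {pos : Fin 3 × Fin 2 → Plane}
    (h : octahedron.IsOuterRACDrawing pos) {i j k : Fin 3} (hij : i ≠ j) (hjk : j ≠ k)
    (hik : i ≠ k) (s t : Fin 2)
    (h₁ : 0 < orient (pos (i, s)) (pos (j, t)) (pos (k, 0))) :
    orient (pos (i, s)) (pos (j, t)) (pos (k, 1)) < 0 := by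
  have adj {i j : Fin 3} {s t : Fin 2} (hij : i ≠ j) : octahedron.Adj (i, s) (j, t) := hij
  by_contra h₂
  have h₂ := lt_of_le_of_ne (not_lt.1 h₂)
    (h.1.orient_ne_zero (adj hij) (adj hjk) (adj hik.symm)).symm
  -- The hub is `(j, t)`; on its rim, `(i, s + 1)` is the antipode of `(i, s)`.
  exact h.wheel (b' := (i, s + 1)) (adj hjk) (adj hij.symm) (adj hjk) (adj hij.symm)
    (adj hik.symm) (adj hik) (adj hik.symm) (adj hik) (by simp) (by simp) h₁ h₂

theorem IsOuterRACDrawing.octahedron_wheel' {pos : Fin 3 × Fin 2 → Plane}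
    (h : octahedron.IsOuterRACDrawing pos) {i j k : Fin 3} (hij : i ≠ j) (hjk : j ≠ k)
    (hik : i ≠ k) (s t : Fin 2)
    (h₁ : orient (pos (i, s)) (pos (j, t)) (pos (k, 0)) < 0) :
    0 < orient (pos (i, s)) (pos (j, t)) (pos (k, 1)) := by
  have := h.octahedron_wheel hij.symm hik hjk t s (by rw [orient_swap]; linarith)
  rw [orient_swap] at this
  linarith

/-- The signed areas of the faces of the octahedron add up to zero, while `octahedron_wheel`
forces them all to have the same sign. -/
theorem IsOuterRACDrawing.octahedron_face_nonpos {pos : Fin 3 × Fin 2 → Plane}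
    (h : octahedron.IsOuterRACDrawing pos) {i j k : Fin 3} (hij : i ≠ j) (hjk : j ≠ k)
    (hik : i ≠ k) : orient (pos (i, 0)) (pos (j, 0)) (pos (k, 0)) ≤ 0 := by
  by_contra! h000
  have hk := h.octahedron_wheel hij hjk hik
  have h001 := hk 0 0 h000
  have hj {s u : Fin 2} (hp : 0 < orient (pos (i, s)) (pos (j, 0)) (pos (k, u))) :
      orient (pos (i, s)) (pos (j, 1)) (pos (k, u)) < 0 := by
    rw [← orient_rotate, ← orient_rotate]
    exact h.octahedron_wheel hik.symm hij hjk.symm _ _ (by rwa [orient_rotate, orient_rotate])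
  have hj' {s u : Fin 2} (hp : orient (pos (i, s)) (pos (j, 0)) (pos (k, u)) < 0) :
      0 < orient (pos (i, s)) (pos (j, 1)) (pos (k, u)) := by
    rw [← orient_rotate, ← orient_rotate]
    exact h.octahedron_wheel' hik.symm hij hjk.symm _ _ (by rwa [orient_rotate, orient_rotate])
  have hi {t u : Fin 2} (hp : 0 < orient (pos (i, 0)) (pos (j, t)) (pos (k, u))) :
      orient (pos (i, 1)) (pos (j, t)) (pos (k, u)) < 0 := by
    rw [← orient_rotate]
    exact h.octahedron_wheel hjk hik.symm hij.symm _ _ (by rwa [orient_rotate])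
  have hi' {t u : Fin 2} (hp : orient (pos (i, 0)) (pos (j, t)) (pos (k, u)) < 0) :
      0 < orient (pos (i, 1)) (pos (j, t)) (pos (k, u)) := by
    rw [← orient_rotate]
    exact h.octahedron_wheel' hjk hik.symm hij.symm _ _ (by rwa [orient_rotate])
  have h010 := hj h000
  have h011 := hj' h001
  have h100 := hi h000
  have h101 := hi' h001
  have h110 := hi' h010
  have h111 := hi h011
  -- The coefficients orient the octahedron coherently, so each edge occurs in both directions and
  -- its contributions cancel.
  have hsum : orient (pos (i, 0)) (pos (j, 0)) (pos (k, 0)) -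
      orient (pos (i, 0)) (pos (j, 0)) (pos (k, 1)) -
      orient (pos (i, 0)) (pos (j, 1)) (pos (k, 0)) +
      orient (pos (i, 0)) (pos (j, 1)) (pos (k, 1)) -
      orient (pos (i, 1)) (pos (j, 0)) (pos (k, 0)) +
      orient (pos (i, 1)) (pos (j, 0)) (pos (k, 1)) +
      orient (pos (i, 1)) (pos (j, 1)) (pos (k, 0)) -
      orient (pos (i, 1)) (pos (j, 1)) (pos (k, 1)) = 0 := by
    unfold orient; ring
  linarith

theorem not_isOuterRAC_octahedron : ¬ octahedron.IsOuterRAC := by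
  rintro ⟨pos, h⟩
  have adj {i j : Fin 3} (hij : i ≠ j) : octahedron.Adj (i, 0) (j, 0) := hij
  have h₁ := h.octahedron_face_nonpos (i := 0) (j := 1) (k := 2) (by simp) (by simp) (by simp)
  -- Exchanging two antipodal pairs reverses the sign of the face, which must then be flat.
  have h₂ := h.octahedron_face_nonpos (i := 1) (j := 0) (k := 2) (by simp) (by simp) (by simp)
  rw [orient_swap] at h₂
  exact h.1.orient_ne_zero (u := (0, 0)) (v := (1, 0)) (w := (2, 0)) (adj (by simp))
    (adj (by simp)) (adj (by simp)) (by linarith)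

/-! ### Planarity by explicit coordinates -/

theorem orient_eq_of_mem_segment {p q r s x : Plane} (hx : x ∈ segment ℝ p q) :
    ∃ a b : ℝ, 0 ≤ a ∧ 0 ≤ b ∧ a + b = 1 ∧ a • p + b • q = x ∧
      orient r s x = a * orient r s p + b * orient r s q := by
  obtain ⟨a, b, ha, hb, hab, rfl⟩ := hx
  refine ⟨a, b, ha, hb, hab, rfl, ?_⟩
  obtain rfl : a = 1 - b := by linarith
  simp [orient]
  ring

theorem orient_eq_zero_of_mem_segment {p q x : Plane} (hx : x ∈ segment ℝ p q) :
    orient p q x = 0 := by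
  obtain ⟨a, b, -, -, -, -, h⟩ := orient_eq_of_mem_segment (r := p) (s := q) hx
  rw [h]
  unfold orient
  ring

/-- The ends `r`, `s` lie strictly on one side of the line `pq`, hence so does the whole segment. -/
theorem disjoint_segment_of_orient_mul_pos {p q r s : Plane}
    (h : 0 < orient p q r * orient p q s) : Disjoint (segment ℝ p q) (segment ℝ r s) := by
  rw [Set.disjoint_left]
  intro x hx hx'
  have h0 := orient_eq_zero_of_mem_segment hx
  obtain ⟨a, b, ha, hb, hab, -, h'⟩ := orient_eq_of_mem_segment (r := p) (s := q) hx'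
  rw [h0] at h'
  rcases mul_pos_iff.1 h with ⟨h₁, h₂⟩ | ⟨h₁, h₂⟩ <;>
    rcases ha.eq_or_lt with rfl | ha' <;> nlinarith

theorem segment_inter_segment_subset {p q r : Plane} (h : orient p q r ≠ 0) :
    segment ℝ p q ∩ segment ℝ p r ⊆ {p} := by
  rintro x ⟨hx, hx'⟩
  have h0 := orient_eq_zero_of_mem_segment hx
  obtain ⟨a, b, -, -, hab, rfl, h'⟩ := orient_eq_of_mem_segment (r := p) (s := q) hx'
  have hp : orient p q p = 0 := by unfold orient; ring
  rw [h0, hp, mul_zero, zero_add, eq_comm, mul_eq_zero] at h'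
  obtain rfl := h'.resolve_right h
  obtain rfl : a = 1 := by linarith
  simp

theorem exists_injective_path_range_eq_segment {p q : Plane} (h : p ≠ q) :
    ∃ γ : _root_.Path p q, Function.Injective γ ∧ Set.range γ = segment ℝ p q := by
  exact ⟨Path.segment p q, (AffineMap.lineMap_injective ℝ h).comp Subtype.val_injective,
    Path.range_segment p q⟩

/-- A placement in general position such that any two disjoint edges are separated by the line
through one of them is a planar drawing. -/
theorem isPlanar_of_orient {V : Type*} {G : SimpleGraph V} (pos : V → Plane)
    (hinj : Function.Injective pos)
    (hgen : ∀ u v w, u ≠ v → v ≠ w → u ≠ w → orient (pos u) (pos v) (pos w) ≠ 0)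
    (hsep : ∀ u v x y, G.Adj u v → G.Adj x y → u ≠ x → u ≠ y → v ≠ x → v ≠ y →
      0 < orient (pos u) (pos v) (pos x) * orient (pos u) (pos v) (pos y) ∨
      0 < orient (pos x) (pos y) (pos u) * orient (pos x) (pos y) (pos v)) :
    G.IsPlanar := by
  refine ⟨pos, Sym2.lift ⟨fun u v => segment ℝ (pos u) (pos v), fun u v => segment_symm ℝ _ _⟩,
    hinj, ?_, ?_, ?_⟩
  · intro u v huv
    exact exists_injective_path_range_eq_segment (hinj.ne huv.ne)
  · intro e
    induction e with | _ u v
    intro huv w hw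
    rw [mem_edgeSet] at huv
    by_contra hwe
    rw [Sym2.mem_iff, not_or] at hwe
    exact hgen u v w huv.ne (Ne.symm hwe.2) (Ne.symm hwe.1) (orient_eq_zero_of_mem_segment hw)
  · have common {u v w : V} (huv : G.Adj u v) (huw : G.Adj u w) (hne : s(u, v) ≠ s(u, w)) :
        segment ℝ (pos u) (pos v) ∩ segment ℝ (pos u) (pos w) ⊆
          pos '' {z | z ∈ s(u, v) ∧ z ∈ s(u, w)} := by
      have hvw : v ≠ w := fun h => hne (h ▸ rfl)
      refine (segment_inter_segment_subset (hgen u v w huv.ne hvw huw.ne)).trans ?_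
      rintro _ rfl
      exact ⟨u, by simp, rfl⟩
    intro e
    induction e with | _ u v
    intro huv f
    induction f with | _ x y
    intro hxy hne
    rw [mem_edgeSet] at huv hxy
    simp only [Sym2.lift_mk]
    by_cases h₁ : u = x
    · subst h₁
      exact common huv hxy hne
    by_cases h₂ : u = y
    · subst h₂
      rw [Sym2.eq_swap (a := x)] at hne ⊢
      rw [segment_symm ℝ (pos x)]
      exact common huv hxy.symm hne
    by_cases h₃ : v = x
    · subst h₃
      rw [Sym2.eq_swap (a := u)] at hne ⊢
      rw [segment_symm ℝ (pos u)]
      exact common huv.symm hxy hne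
    by_cases h₄ : v = y
    · subst h₄
      rw [Sym2.eq_swap (a := u), Sym2.eq_swap (a := x)] at hne ⊢
      rw [segment_symm ℝ (pos u), segment_symm ℝ (pos x)]
      exact common huv.symm hxy.symm hne
    have hd : Disjoint (segment ℝ (pos u) (pos v)) (segment ℝ (pos x) (pos y)) := by
      rcases hsep u v x y huv hxy h₁ h₂ h₃ h₄ with h | h
      · exact disjoint_segment_of_orient_mul_pos h
      · exact (disjoint_segment_of_orient_mul_pos h).symm
    rw [hd.inter_eq]
    exact Set.empty_subset _

/-- Integer coordinates of a planar straight-line drawing of the octahedron: a triangle inside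
a triangle. -/
def octahedronCoord : Fin 3 × Fin 2 → ℤ × ℤ
  | (0, 0) => (0, 10)
  | (1, 0) => (-9, -6)
  | (2, 0) => (10, -5)
  | (0, 1) => (1, -3)
  | (1, 1) => (3, 1)
  | (2, 1) => (-2, 2)

/-- `orient` for the integer placement `octahedronCoord`. -/
def octahedronOrient (u v w : Fin 3 × Fin 2) : ℤ :=
  ((octahedronCoord v).1 - (octahedronCoord u).1) *
      ((octahedronCoord w).2 - (octahedronCoord u).2) -
    ((octahedronCoord v).2 - (octahedronCoord u).2) *
      ((octahedronCoord w).1 - (octahedronCoord u).1)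

theorem isPlanar_octahedron : octahedron.IsPlanar := by
  let pos : Fin 3 × Fin 2 → Plane := fun v =>
    !₂[((octahedronCoord v).1 : ℝ), (octahedronCoord v).2]
  have horient (u v w : Fin 3 × Fin 2) :
      orient (pos u) (pos v) (pos w) = (octahedronOrient u v w : ℝ) := by
    simp [pos, orient, octahedronOrient]
  refine isPlanar_of_orient pos ?_ ?_ ?_
  · intro u v huv
    have h0 := congrArg (fun p : Plane => p 0) huv
    have h1 := congrArg (fun p : Plane => p 1) huv
    simp only [pos, Matrix.cons_val_zero, Matrix.cons_val_one, Int.cast_inj]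
      at h0 h1
    have hinj : ∀ u v, octahedronCoord u = octahedronCoord v → u = v := by decide
    exact hinj u v (Prod.ext h0 h1)
  · intro u v w
    rw [horient, Int.cast_ne_zero]
    revert u v w
    decide
  · intro u v x y
    simp only [horient]
    norm_cast
    revert u v x y
    decide +kernel

/-! ### Connectivity and degree -/

theorem isTriconnected_octahedron : octahedron.IsTriconnected := by
  refine ⟨by simp; norm_num, fun X hX => ?_⟩
  have hne : ∃ w, w ∉ X := by
    by_contra! h
    have := Finset.card_le_card (fun w _ => h w : Finset.univ ⊆ X)
    simp at this
    omega
  -- Antipodal vertices have four common neighbours, and at most two vertices are deleted.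
  have key : ∀ X : Finset (Fin 3 × Fin 2), X.card < 3 → ∀ u v, u ∉ X → v ∉ X →
      u = v ∨ octahedron.Adj u v ∨ ∃ w, w ∉ X ∧ octahedron.Adj u w ∧ octahedron.Adj w v := by
    decide +kernel
  obtain ⟨w, hw⟩ := hne
  have : Nonempty {v : Fin 3 × Fin 2 | v ∉ X} := ⟨⟨w, hw⟩⟩
  refine Connected.mk fun ⟨u, hu⟩ ⟨v, hv⟩ => ?_
  rcases key X hX u v hu hv with rfl | h | ⟨w, hw, h₁, h₂⟩
  · exact Reachable.refl _
  · exact Adj.reachable (by simpa using h)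
  · exact (Adj.reachable (v := ⟨w, hw⟩) (by simpa using h₁)).trans
      (Adj.reachable (by simpa using h₂))

theorem maxDegree_octahedron : octahedron.maxDegree = 4 := by
  decide +kernel

end SimpleGraph

/-- The octahedron is a planar triconnected graph of maximum degree 4 that is not outer-RAC. -/
theorem mainTheorem6 :
    SimpleGraph.octahedron.IsPlanar ∧
    SimpleGraph.octahedron.IsTriconnected ∧
    SimpleGraph.octahedron.maxDegree = 4 ∧
    ¬ SimpleGraph.octahedron.IsOuterRAC :=
  ⟨SimpleGraph.isPlanar_octahedron, SimpleGraph.isTriconnected_octahedron,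
    SimpleGraph.maxDegree_octahedron, SimpleGraph.not_isOuterRAC_octahedron⟩
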